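/- **Definitions.** A *signed bi-graph* $(G,\sigma)$ is a finite non-empty loopless multigraph $G$ with a signature $\sigma:E(G)\to\{1,-1\}$ such that any two distinct vertices are joined by at most two edges, and two parallel edges have distinct signs. For a positive integer $k$, a *$k$-coloring* of $(G,\sigma)$ is a map $c:V(G)\to\mathbb{Z}_k$ (integers modulo $k$) with $c(v)\neq\sigma(e)c(w)$ for each edge $e=vw$; $(G,\sigma)$ is *$k$-colorable* if it has a $k$-coloring, and its *chromatic number* is the smallest positive $k$ for which it is $k$-colorable. $(K_q,+)$ is the complete graph on $q$ vertices with all edges positive. For an integer $k\ge 0$, a signed bi-graph is *$k$-thin* if it arises from a bi-complete one (every two distinct vertices are joined by both a positive and a negative edge) by removing at most $k$ pairwise vertex-disjoint edges. Consider the following operations on signed bi-graphs (edges of the same sign that become parallel are merged). * (sb1) Add a vertex, or add a signed edge between two distinct vertices. * (sb2) Identify two nonadjacent vertices. * (sb3) Given vertex-disjoint signed bi-graphs $(G_1,\sigma_1)$, $(G_2,\sigma_2)$, a vertex $v$ of $G_1$ and a positive edge $e$ of $G_2$ with ends $x,y$: split $v$ into two new vertices $v_1,v_2$ (each edge at $v$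 is attached to exactly one of $v_1,v_2$), remove $e$, and identify $v_1$ with $x$ and $v_2$ with $y$. * (sb4) Switch at a vertex, i.e. reverse the signs of all edges incident with it. * (sb5) with parameter $p$, where $p$ is a positive integer, applied to a signed bi-graph that is not $p$-colorable: if $p$ is even, remove a vertex that has at most $p/2$ neighbors; if $p\geq 3$ is odd, remove a negative edge whose ends are joined by no other edge, identify these two ends, and add signed edges so that the resulting signed bi-graph is $\frac{p-3}{2}$-thin. **Theorem (Hajós-like theorem).** Every signed bi-graph with chromatic number $q$ can be obtained, up to isomorphism, from copies of $(K_q,+)$ by operations (sb1)–(sb5), where (sb5) is used only with parameters $p\geq q-1$. -/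

import Mathlib

universe u

/-- A signed bi-graph on the vertex set `V`: there are no loops, and between two distinct vertices
there is at most one edge of each sign (so at most two edges, and two parallel edges have distinct
signs).  `G.Adj s a b` says that `a` and `b` are joined by an edge of sign `s ∈ {1, -1}`. -/
@[ext]
structure SignedBigraph (V : Type u) where
  Adj : ℤˣ → V → V → Prop
  symm : ∀ s a b, Adj s a b → Adj s b a
  loopless : ∀ s a, ¬ Adj s a a

namespace SignedBigraph

variable {V W : Type u}

/-- `c : V → ℤ/k` is a `k`-coloring if `c v ≠ σ(e) c w` for every edge `e = vw`. -/
def IsColoring (G : SignedBigraph V) (k : ℕ) (c : V → ZMod k) : Prop :=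
  ∀ s v w, G.Adj s v w → c v ≠ ((s : ℤ) : ZMod k) * c w

def Colorable (G : SignedBigraph V) (k : ℕ) : Prop :=
  ∃ c : V → ZMod k, G.IsColoring k c

/-- `q` is the smallest positive integer `k` such that `G` has a `k`-coloring. -/
def HasChromaticNumber (G : SignedBigraph V) (q : ℕ) : Prop :=
  IsLeast {k : ℕ | 0 < k ∧ G.Colorable k} q

/-- The complete graph on `V` with the all-positive signature. -/
def positiveComplete (V : Type u) : SignedBigraph V where
  Adj s a b := s = 1 ∧ a ≠ b
  symm _ _ _ h := ⟨h.1, h.2.symm⟩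
  loopless _ _ h := h.2 rfl

/-- Vertices joined by no edge of either sign. -/
def Nonadjacent (G : SignedBigraph V) (x y : V) : Prop :=
  ∀ s, ¬ G.Adj s x y

/-- Vertices joined to `v` by at least one edge. -/
def neighbors (G : SignedBigraph V) (v : V) : Set V :=
  {w | ∃ s, G.Adj s v w}

/-- `H` arises from `G` by adding (zero or more) signed edges. -/
def IsSpanningSubgraph (G H : SignedBigraph V) : Prop :=
  ∀ s a b, G.Adj s a b → H.Adj s a b

/-- A bi-complete signed bi-graph minus at most `k` pairwise vertex-disjoint edges; an edge is
given by its two (distinct) ends and its sign. -/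
def IsThin (G : SignedBigraph V) (k : ℕ) : Prop :=
  ∃ M : Finset (Sym2 V × ℤˣ), M.card ≤ k ∧
    (∀ e ∈ M, ¬ e.1.IsDiag) ∧
    (∀ e ∈ M, ∀ f ∈ M, e ≠ f → ∀ v, ¬ (v ∈ e.1 ∧ v ∈ f.1)) ∧
    ∀ s a b, G.Adj s a b ↔ a ≠ b ∧ (s(a, b), s) ∉ M

/-- Add an isolated vertex. -/
def addVertex (G : SignedBigraph V) : SignedBigraph (Option V) where
  Adj s a b := ∃ a' b', a = some a' ∧ b = some b' ∧ G.Adj s a' b'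
  symm := by
    rintro s a b ⟨a', b', ha, hb, h⟩
    exact ⟨b', a', hb, ha, G.symm _ _ _ h⟩
  loopless := by
    rintro s a ⟨a', b', ha, hb, h⟩
    obtain rfl : a' = b' := Option.some.inj (ha.symm.trans hb)
    exact G.loopless _ _ h

/-- Add an edge of sign `s` between `x` and `y` (used for `x ≠ y`). -/
def addEdge (G : SignedBigraph V) (s : ℤˣ) (x y : V) : SignedBigraph V where
  Adj t a b := G.Adj t a b ∨ (a ≠ b ∧ t = s ∧ s(a, b) = s(x, y))
  symm := by
    rintro t a b (h | ⟨h, ht, he⟩)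
    · exact Or.inl (G.symm _ _ _ h)
    · exact Or.inr ⟨h.symm, ht, Sym2.eq_swap.trans he⟩
  loopless := by
    rintro t a (h | ⟨h, -⟩)
    · exact G.loopless _ _ h
    · exact h rfl

/-- Remove the edge of sign `s` between `x` and `y`. -/
def removeEdge (G : SignedBigraph V) (s : ℤˣ) (x y : V) : SignedBigraph V where
  Adj t a b := G.Adj t a b ∧ ¬ (t = s ∧ s(a, b) = s(x, y))
  symm := by
    rintro t a b ⟨h, hn⟩
    exact ⟨G.symm _ _ _ h, fun ⟨ht, he⟩ => hn ⟨ht, Sym2.eq_swap.trans he⟩⟩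
  loopless _ _ h := G.loopless _ _ h.1

/-- Remove the vertex `u`. -/
def removeVertex (G : SignedBigraph V) (u : V) : SignedBigraph {w : V // w ≠ u} where
  Adj s a b := G.Adj s a b
  symm _ _ _ h := G.symm _ _ _ h
  loopless _ _ h := G.loopless _ _ h

/-- Identify `y` with `x`; the resulting vertex is called `x`.  Edges of the same sign that become
parallel are merged.  This is only used for distinct nonadjacent `x` and `y`, where no loop can
arise, so that the clause `a ≠ b` holds automatically. -/
def identify (G : SignedBigraph V) (x y : V) : SignedBigraph {w : V // w ≠ y} where
  Adj s a b := a ≠ b ∧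
    (G.Adj s a b ∨ ((a : V) = x ∧ G.Adj s y b) ∨ ((b : V) = x ∧ G.Adj s a y))
  symm := by
    rintro s a b ⟨hab, h | ⟨h, h'⟩ | ⟨h, h'⟩⟩
    · exact ⟨hab.symm, Or.inl (G.symm _ _ _ h)⟩
    · exact ⟨hab.symm, Or.inr (Or.inr ⟨h, G.symm _ _ _ h'⟩)⟩
    · exact ⟨hab.symm, Or.inr (Or.inl ⟨h, G.symm _ _ _ h'⟩)⟩
  loopless _ _ h := h.1 rfl

/-- Switch at `v`: change the sign of exactly the edges incident to `v`. -/
def switch (G : SignedBigraph V) (v : V) : SignedBigraph V where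
  Adj s a b := ((a = v ∨ b = v) ∧ G.Adj (-s) a b) ∨ (¬ (a = v ∨ b = v) ∧ G.Adj s a b)
  symm := by
    rintro s a b (⟨h, h'⟩ | ⟨h, h'⟩)
    · exact Or.inl ⟨h.symm, G.symm _ _ _ h'⟩
    · exact Or.inr ⟨fun hh => h hh.symm, G.symm _ _ _ h'⟩
  loopless := by
    rintro s a (⟨-, h⟩ | ⟨-, h⟩) <;> exact G.loopless _ _ h

/-- Adjacency of the graph made from the vertex-disjoint graphs `G₁` and `G₂` by splitting the
vertex `v` of `G₁` into `v₁` and `v₂`, removing the positive edge `xy` of `G₂`, and identifying `v₁`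
with `x` and `v₂` with `y`.  The edge of sign `s` from `v` to `a` is attached to `v₁` if
`a ∈ S s` and to `v₂` otherwise. -/
def splitJoinAdj (G₁ : SignedBigraph V) (G₂ : SignedBigraph W) (v : V) (S : ℤˣ → Set V)
    (x y : W) (s : ℤˣ) : {w : V // w ≠ v} ⊕ W → {w : V // w ≠ v} ⊕ W → Prop
  | .inl a, .inl b => G₁.Adj s a b
  | .inl a, .inr b => G₁.Adj s v a ∧ ((b = x ∧ (a : V) ∈ S s) ∨ (b = y ∧ (a : V) ∉ S s))
  | .inr b, .inl a => G₁.Adj s v a ∧ ((b = x ∧ (a : V) ∈ S s) ∨ (b = y ∧ (a : V) ∉ S s))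
  | .inr a, .inr b => (G₂.removeEdge 1 x y).Adj s a b

/-- The graph with adjacency `splitJoinAdj`. -/
def splitJoin (G₁ : SignedBigraph V) (G₂ : SignedBigraph W) (v : V) (S : ℤˣ → Set V)
    (x y : W) : SignedBigraph ({w : V // w ≠ v} ⊕ W) where
  Adj := splitJoinAdj G₁ G₂ v S x y
  symm := by
    rintro s (a | a) (b | b) h
    · exact G₁.symm _ _ _ h
    · exact h
    · exact h
    · exact (G₂.removeEdge 1 x y).symm _ _ _ h
  loopless := by
    rintro s (a | a) h
    · exact G₁.loopless _ _ h
    · exact (G₂.removeEdge 1 x y).loopless _ _ h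

/-- The signed bi-graphs that can be obtained from (copies of) the all-positive complete graph on
`q` vertices by the operations (sb1)-(sb5), up to isomorphism.

(sb5) is an operation on the class of signed bi-graphs that are not `p`-colorable, and `p` is its
parameter: it may be applied with parameter `p` to a graph that is not `p`-colorable.  Only
parameters `p ≥ q - 1` are used, so every graph on the way is not `(q - 1)`-colorable. -/
inductive Obtainable (q : ℕ) : {V : Type u} → SignedBigraph V → Prop
  /-- the starting graph -/
  | start : Obtainable q (positiveComplete (ULift.{u} (Fin q)))
  /-- renaming of vertices -/
  | iso {V W : Type u} {G : SignedBigraph V} {H : SignedBigraph W} (e : V ≃ W)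
      (he : ∀ s a b, H.Adj s (e a) (e b) ↔ G.Adj s a b) :
      Obtainable q G → Obtainable q H
  /-- (sb1), adding a vertex -/
  | sb1_vertex {V : Type u} {G : SignedBigraph V} :
      Obtainable q G → Obtainable q G.addVertex
  /-- (sb1), adding a signed edge -/
  | sb1_edge {V : Type u} {G : SignedBigraph V} (s : ℤˣ) (x y : V) (hxy : x ≠ y) :
      Obtainable q G → Obtainable q (G.addEdge s x y)
  /-- (sb2), identifying two nonadjacent vertices -/
  | sb2 {V : Type u} {G : SignedBigraph V} (x y : V) (hxy : x ≠ y) (h : G.Nonadjacent x y) :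
      Obtainable q G → Obtainable q (G.identify x y)
  /-- (sb3), splitting a vertex of one graph and removing a positive edge of another -/
  | sb3 {V W : Type u} {G₁ : SignedBigraph V} {G₂ : SignedBigraph W} (v : V) (S : ℤˣ → Set V)
      (x y : W) (h : G₂.Adj 1 x y) :
      Obtainable q G₁ → Obtainable q G₂ → Obtainable q (splitJoin G₁ G₂ v S x y)
  /-- (sb4), switching at a vertex -/
  | sb4 {V : Type u} {G : SignedBigraph V} (v : V) :
      Obtainable q G → Obtainable q (G.switch v)
  /-- (sb5) for even `p`, removing a vertex with at most `p / 2` neighbors -/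
  | sb5_even {V : Type u} {G : SignedBigraph V} (p : ℕ) (hp : 0 < p) (hq : q ≤ p + 1)
      (heven : Even p) (hG : ¬ G.Colorable p) (u : V) (hu : 2 * (G.neighbors u).ncard ≤ p) :
      Obtainable q G → Obtainable q (G.removeVertex u)
  /-- (sb5) for odd `p`, with `k = (p - 3) / 2` a nonnegative integer: removing a negative edge
  whose ends are joined by no other edge, identifying its ends, and adding signed edges so that the
  result `H` is `k`-thin -/
  | sb5_odd {V : Type u} {G : SignedBigraph V} (p k : ℕ) (hk : p = 2 * k + 3) (hq : q ≤ p + 1)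
      (hG : ¬ G.Colorable p) (x y : V) (hneg : G.Adj (-1) x y) (hpos : ¬ G.Adj 1 x y)
      (H : SignedBigraph {w : V // w ≠ y})
      (hH : ((G.removeEdge (-1) x y).identify x y).IsSpanningSubgraph H) (hthin : H.IsThin k) :
      Obtainable q G → Obtainable q H

end SignedBigraph

/-! Write q = p + 1. The case p = 0 is trivial. For p ≥ 1, a graph that is not p-colorable and not
obtainable extends to an edge-maximal nonobtainable graph M on the same vertices. As in the
classical Hajós theorem, (sb3) makes "not joined by both signs" an equivalence relation
(`not_adj_trans`), and it makes every class antibalanced (`exists_signs`). Let N be the number of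
classes and b the number of classes containing an edge. Three facts bound them. A switched positive
clique gives N + b ≤ p (`card_add_card_lt`). Odd (sb5) makes p/2 + 2 pairwise bijoined vertices
obtainable, so N ≤ p/2 + 1 (`Bijoined.obtainable`). If moreover 2b < p, one absolute value per class
colors M (`colorable`). As M is not p-colorable, p ≤ 2b ≤ 2N, hence p = 2N (`card_quotient`). Now
join a new vertex by both signs to one representative of each class. Even (sb5) could delete it
again, so the enlarged graph is nonobtainable too, and it is still not p-colorable. A maximal
extension of it must again have exactly p/2 = N classes, yet it contains N + 1 pairwise bijoined
vertices, a contradiction. -/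

namespace SignedBigraph

open Function

variable {V W I : Type u} {q : ℕ}

/-! ### Closure of `Obtainable` under homomorphisms up to switching -/

/-- The vertices `r i` are pairwise joined by edges of both signs. -/
def Bijoined {ι : Type*} (G : SignedBigraph V) (r : ι → V) : Prop :=
  ∀ i j, i ≠ j → ∀ s, G.Adj s (r i) (r j)

lemma ne_of_adj (G : SignedBigraph V) {s : ℤˣ} {a b : V} (h : G.Adj s a b) : a ≠ b := by
  rintro rfl
  exact G.loopless _ _ h

/-- Switch at all vertices `v` with `τ v = -1`. -/
def switchBy (G : SignedBigraph V) (τ : V → ℤˣ) : SignedBigraph V where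
  Adj s a b := G.Adj (τ a * τ b * s) a b
  symm s a b h := by
    rw [mul_comm (τ b)]
    exact G.symm _ _ _ h
  loopless _ _ h := G.loopless _ _ h

lemma obtainable_switchBy [Finite V] (G : SignedBigraph V) (hG : Obtainable q G) (τ : V → ℤˣ) :
    Obtainable q (G.switchBy τ) := by
  classical
  have key : ∀ n : ℕ, ∀ (G : SignedBigraph V) (τ : V → ℤˣ), {v | τ v ≠ 1}.ncard = n →
      Obtainable q G → Obtainable q (G.switchBy τ) := by
    intro n
    induction n with
    | zero =>
      intro G τ hn hG
      rw [Set.ncard_eq_zero] at hn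
      have h1 : ∀ v, τ v = 1 := fun v => by
        by_contra h
        exact Set.eq_empty_iff_forall_notMem.1 hn v h
      have : G.switchBy τ = G := by
        ext s a b
        simp [switchBy, h1]
      rwa [this]
    | succ n ih =>
      intro G τ hn hG
      obtain ⟨v, hv⟩ : {v | τ v ≠ 1}.Nonempty := by
        rw [← Set.ncard_pos]
        omega
      have hv' : τ v = -1 := (Int.units_eq_one_or _).resolve_left hv
      have hset : {w | update τ v 1 w ≠ 1} = {w | τ w ≠ 1} \ {v} := by
        ext w
        by_cases h : w = v
        · simp [h]
        · simp [h]
      have hcard : {w | update τ v 1 w ≠ 1}.ncard = n := by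
        rw [hset, Set.ncard_sdiff_singleton_of_mem hv, hn]
        rfl
      have := ih (G.switch v) (update τ v 1) hcard (.sb4 v hG)
      convert this using 1
      ext s a b
      by_cases hab : a = b
      · subst hab
        exact iff_of_false (loopless _ _ _) (loopless _ _ _)
      by_cases ha : a = v
      · subst ha
        simp [switchBy, switch, hv', Ne.symm hab]
      · by_cases hb : b = v
        · subst hb
          simp [switchBy, switch, hv', ha]
        · simp [switchBy, switch, ha, hb]
  exact key _ G τ rfl hG

lemma obtainable_of_isSpanningSubgraph [Finite V] {G H : SignedBigraph V}
    (hGH : G.IsSpanningSubgraph H) (hG : Obtainable q G) : Obtainable q H := by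
  have key : ∀ n : ℕ, ∀ G : SignedBigraph V, G.IsSpanningSubgraph H →
      {x : ℤˣ × V × V | H.Adj x.1 x.2.1 x.2.2 ∧ ¬ G.Adj x.1 x.2.1 x.2.2}.ncard = n →
      Obtainable q G → Obtainable q H := by
    intro n
    induction n using Nat.strong_induction_on with
    | _ n ih =>
      intro G hGH hn hG
      by_cases hall : ∀ s a b, H.Adj s a b → G.Adj s a b
      · have : H = G := by
          ext s a b
          exact ⟨hall s a b, hGH s a b⟩
        rwa [this]
      · push Not at hall
        obtain ⟨s, a, b, hH, hGab⟩ := hall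
        refine ih _ ?_ (G.addEdge s a b) ?_ rfl (.sb1_edge s a b (H.ne_of_adj hH) hG)
        · rw [← hn]
          refine Set.ncard_lt_ncard ?_ (Set.toFinite _)
          refine ⟨fun x hx => ⟨hx.1, fun h => hx.2 (Or.inl h)⟩, fun hsub => ?_⟩
          exact (hsub (show (s, a, b) ∈ _ from ⟨hH, hGab⟩)).2 (Or.inr ⟨H.ne_of_adj hH, rfl, rfl⟩)
        · rintro t x y (h | ⟨-, rfl, h⟩)
          · exact hGH _ _ _ h
          · rcases Sym2.eq_iff.1 h with ⟨rfl, rfl⟩ | ⟨rfl, rfl⟩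
            · exact hH
            · exact H.symm _ _ _ hH
  exact key _ G hGH rfl hG

lemma obtainable_of_injective_hom [Finite W] {H : SignedBigraph W} (n : ℕ) :
    ∀ {V : Type u} (G : SignedBigraph V) (f : V → W), Injective f →
      (∀ s a b, G.Adj s a b → H.Adj s (f a) (f b)) → (Set.range f)ᶜ.ncard = n →
      Obtainable q G → Obtainable q H := by
  induction n with
  | zero =>
    intro V G f hf hom hn hG
    rw [Set.ncard_eq_zero, Set.compl_empty_iff, Set.range_eq_univ] at hn
    let e : V ≃ W := Equiv.ofBijective f ⟨hf, hn⟩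
    let K : SignedBigraph W :=
      { Adj := fun s a b => G.Adj s (e.symm a) (e.symm b)
        symm := fun s a b h => G.symm _ _ _ h
        loopless := fun s a h => G.loopless _ _ h }
    have hK : Obtainable q K := .iso e (fun s a b => by simp [K]) hG
    refine obtainable_of_isSpanningSubgraph (fun s a b h => ?_) hK
    have := hom _ _ _ h
    rwa [show f (e.symm a) = a from e.apply_symm_apply a,
      show f (e.symm b) = b from e.apply_symm_apply b] at this
  | succ n ih =>
    intro V G f hf hom hn hG
    obtain ⟨w, hw⟩ : (Set.range f)ᶜ.Nonempty := by
      rw [← Set.ncard_pos]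
      omega
    refine ih G.addVertex (fun o => o.elim w f) ?_ ?_ ?_ (.sb1_vertex hG)
    · rintro (_ | a) (_ | b) h
      · rfl
      · exact absurd ⟨b, h.symm⟩ hw
      · exact absurd ⟨a, h⟩ hw
      · exact congrArg some (hf h)
    · rintro s _ _ ⟨a, b, rfl, rfl, h⟩
      exact hom _ _ _ h
    · have : (Set.range fun o : Option V => o.elim w f)ᶜ = (Set.range f)ᶜ \ {w} := by
        ext x
        simp only [Set.mem_compl_iff, Set.mem_range, Option.exists, Option.elim_none,
          Option.elim_some, Set.mem_sdiff, Set.mem_singleton_iff]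
        tauto
      rw [this, Set.ncard_sdiff_singleton_of_mem hw, hn]
      rfl

/-- Two vertices with the same image are nonadjacent because the target is loopless, so (sb2) merges
them. Once the map is injective, (sb1) supplies the missing vertices and edges. -/
lemma obtainable_of_hom [Finite W] {H : SignedBigraph W} (n : ℕ) :
    ∀ {V : Type u} [Finite V] (G : SignedBigraph V) (f : V → W), Nat.card V = n →
      (∀ s a b, G.Adj s a b → H.Adj s (f a) (f b)) →
      Obtainable q G → Obtainable q H := by
  induction n using Nat.strong_induction_on with
  | _ n ih =>
    intro V _ G f hn hom hG
    by_cases hf : Injective f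
    · exact obtainable_of_injective_hom _ G f hf hom rfl hG
    · simp only [Injective, not_forall] at hf
      obtain ⟨x, y, hxy, hne⟩ := hf
      have hnon : G.Nonadjacent x y := fun s h => by
        have := hom _ _ _ h
        rw [hxy] at this
        exact H.loopless _ _ this
      refine ih _ ?_ (G.identify x y) (fun w => f w) rfl ?_ (.sb2 x y hne hnon hG)
      · rw [← hn]
        exact Finite.card_subtype_lt (x := y) (by simp)
      · rintro s a b ⟨-, h | ⟨ha, h⟩ | ⟨hb, h⟩⟩
        · exact hom _ _ _ h
        · rw [ha, hxy]
          exact hom _ _ _ h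
        · rw [hb, hxy]
          exact hom _ _ _ h

/-- Obtainability passes along homomorphisms composed with a switching `τ`. -/
lemma obtainable_of_switchHom [Finite V] [Finite W] {G : SignedBigraph V} {H : SignedBigraph W}
    (hG : Obtainable q G) (f : V → W) (τ : V → ℤˣ)
    (hom : ∀ s a b, G.Adj s a b → H.Adj (τ a * τ b * s) (f a) (f b)) : Obtainable q H := by
  refine obtainable_of_hom _ (G.switchBy τ) f rfl (fun s a b h => ?_)
    (obtainable_switchBy G hG τ)
  have h2 := hom _ _ _ h
  have : τ a * τ b * (τ a * τ b * s) = s := by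
    rw [← mul_assoc, Int.units_mul_self, one_mul]
  rwa [this] at h2

/-- A graph containing a switched copy of a positive complete graph on `q` vertices. -/
lemma obtainable_of_switched_clique [Finite V] [Finite W] {H : SignedBigraph W} (τ : V → ℤˣ)
    (f : V → W) (hV : q ≤ Nat.card V)
    (hf : ∀ a b, a ≠ b → H.Adj (τ a * τ b) (f a) (f b)) : Obtainable q H := by
  let e := Finite.equivFin V
  let g : ULift.{u} (Fin q) → V := fun i => e.symm (Fin.castLE hV i.down)
  have hg : Injective g := fun i j h => by
    have := Fin.castLE_injective hV (e.symm.injective h)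
    exact ULift.ext _ _ this
  refine obtainable_of_switchHom .start (f ∘ g) (τ ∘ g) ?_
  rintro s a b ⟨rfl, hab⟩
  simpa using hf _ _ (hg.ne hab)

/-! ### Colorings -/

lemma Colorable.of_isSpanningSubgraph {G H : SignedBigraph V} {p : ℕ}
    (h : G.IsSpanningSubgraph H) (hH : H.Colorable p) : G.Colorable p := by
  obtain ⟨c, hc⟩ := hH
  exact ⟨c, fun s v w hvw => hc _ _ _ (h _ _ _ hvw)⟩

/-- A coloring separates the members of a bijoined family by absolute value. -/
lemma Bijoined.card_le {G : SignedBigraph V} {ι : Type*} [Finite ι] {r : ι → V}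
    (hr : G.Bijoined r) {p : ℕ} (hp : 0 < p) (hG : G.Colorable p) : Nat.card ι ≤ p / 2 + 1 := by
  have : NeZero p := ⟨hp.ne'⟩
  obtain ⟨c, hc⟩ := hG
  -- Equal absolute values mean equal or opposite colors. The positive edge forbids the former, the
  -- negative edge the latter.
  let φ : ι → Fin (p / 2 + 1) := fun i =>
    ⟨(c (r i)).valMinAbs.natAbs, Nat.lt_succ_of_le (ZMod.natAbs_valMinAbs_le _)⟩
  have hφ : Injective φ := by
    intro i j h
    by_contra hij
    have h' : (c (r i)).valMinAbs.natAbs = (c (r j)).valMinAbs.natAbs := congrArg Fin.val h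
    rw [Int.natAbs_eq_natAbs_iff] at h'
    rcases h' with h' | h'
    · apply hc 1 _ _ (hr i j hij 1)
      have := congrArg (fun z : ℤ => (z : ZMod p)) h'
      simpa using this
    · apply hc (-1) _ _ (hr i j hij (-1))
      have := congrArg (fun z : ℤ => (z : ZMod p)) h'
      simpa using this
  simpa using Nat.card_le_card_of_injective φ hφ

/-- Coloring the vertex `v` with `τ v * ℓ v`, where `ℓ v` is at most `p / 2`. -/
lemma colorable_of_labels {G : SignedBigraph V} {p : ℕ} (ℓ : V → ℕ) (τ : V → ℤˣ)
    (hℓ : ∀ v, ℓ v ≤ p / 2)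
    (h : ∀ s a b, G.Adj s a b → ℓ a = ℓ b →
      s = -(τ a * τ b) ∧ 0 < ℓ a ∧ 2 * ℓ a < p) : G.Colorable p := by
  refine ⟨fun v => (((τ v : ℤ) * (ℓ v : ℤ) : ℤ) : ZMod p), fun s a b hab heq => ?_⟩
  rw [← Int.cast_mul, ZMod.intCast_eq_intCast_iff_dvd_sub] at heq
  have ha := hℓ a
  have hb := hℓ b
  have hne : ℓ a ≠ ℓ b ∨ (s = -(τ a * τ b) ∧ 0 < ℓ a ∧ 2 * ℓ a < p) := by
    by_cases hl : ℓ a = ℓ b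
    · exact Or.inr (h _ _ _ hab hl)
    · exact Or.inl hl
  obtain ⟨z, hz⟩ := heq
  have hcase : (p : ℤ) ∣ (ℓ a : ℤ) - ℓ b ∨ (p : ℤ) ∣ (ℓ a : ℤ) + ℓ b := by
    rcases Int.units_eq_one_or s with rfl | rfl <;>
    rcases Int.units_eq_one_or (τ a) with h1 | h1 <;>
    rcases Int.units_eq_one_or (τ b) with h2 | h2 <;>
    simp only [h1, h2, Units.val_one, Units.val_neg] at hz <;>
    first
    | exact Or.inl ⟨z, by linarith⟩
    | exact Or.inl ⟨-z, by linarith⟩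
    | exact Or.inr ⟨z, by linarith⟩
    | exact Or.inr ⟨-z, by linarith⟩
  -- Labels lie in [0, p/2], so a nonzero sum divisible by p equals p, and then both labels are p/2.
  have hsum : ℓ a = ℓ b := by
    rcases hcase with hd | hd
    · have := Int.eq_zero_of_abs_lt_dvd hd (by rw [abs_lt]; omega)
      omega
    · have hd' : p ∣ ℓ a + ℓ b := by exact_mod_cast hd
      rcases Nat.eq_zero_or_pos (ℓ a + ℓ b) with h0 | h0
      · omega
      · have := Nat.le_of_dvd h0 hd'
        omega
  obtain ⟨hs, hpos, hlt⟩ := hne.resolve_left (not_not.2 hsum)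
  -- The sign of the edge asks for a color equal to its own negative; only 0 and p/2 are, and both
  -- are excluded.
  have hd : (p : ℤ) ∣ 2 * (ℓ a : ℤ) := by
    rcases Int.units_eq_one_or (τ a) with h1 | h1 <;>
    rcases Int.units_eq_one_or (τ b) with h2 | h2 <;>
    simp only [hs, ← hsum, h1, h2, Units.val_one, Units.val_neg, one_mul, mul_one, neg_neg,
      mul_neg, neg_mul] at hz <;>
    first
    | exact ⟨z, by linarith⟩
    | exact ⟨-z, by linarith⟩
  have hd' : p ∣ 2 * ℓ a := by exact_mod_cast hd
  have := Nat.le_of_dvd (by omega) hd'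
  omega

/-! ### Bi-complete graphs -/

/-- Blow up the vertices of a bi-complete graph on `I` to negative cliques, the fibers of `idx`. -/
def negBlowup (idx : W → I) : SignedBigraph W where
  Adj s a b := idx a ≠ idx b ∨ (a ≠ b ∧ s = -1)
  symm _ _ _ h := h.imp Ne.symm (And.imp_left Ne.symm)
  loopless := by simp

/-- By `hfib` a fiber holds its representative and at most one further vertex. The missing edges are
the positive ones inside two-element fibers, one for each non-representative. -/
lemma negBlowup_isThin [Finite W] [Finite I] (idx : W → I) (r : I → W) (hr : ∀ i, idx (r i) = i)
    (hfib : ∀ a b, idx a = idx b → a = b ∨ a = r (idx a) ∨ b = r (idx b)) (k : ℕ)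
    (hk : Nat.card W ≤ Nat.card I + k) : (negBlowup idx).IsThin k := by
  classical
  cases nonempty_fintype W
  cases nonempty_fintype I
  have hrinj : Injective r := fun i j h => by rw [← hr i, h, hr]
  let N : Finset W := (Finset.univ.image r)ᶜ
  have hN : ∀ w, w ∈ N ↔ w ≠ r (idx w) := by
    intro w
    simp only [N, Finset.mem_compl, Finset.mem_image, Finset.mem_univ, true_and]
    refine not_congr ⟨?_, fun h => ⟨_, h.symm⟩⟩
    rintro ⟨i, rfl⟩
    rw [hr]
  refine ⟨N.image fun w => (s(w, r (idx w)), 1), ?_, ?_, ?_, ?_⟩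
  · refine Finset.card_image_le.trans ?_
    rw [Finset.card_compl, Finset.card_image_of_injective _ hrinj, Finset.card_univ,
      ← Nat.card_eq_fintype_card, ← Nat.card_eq_fintype_card]
    omega
  · intro e he
    obtain ⟨w, hw, rfl⟩ := Finset.mem_image.1 he
    simpa using (hN w).1 hw
  · intro e he f hf hef v hv
    obtain ⟨w, hw, rfl⟩ := Finset.mem_image.1 he
    obtain ⟨x, hx, rfl⟩ := Finset.mem_image.1 hf
    rw [hN] at hw hx
    simp only [Sym2.mem_iff] at hv
    have h1 : idx v = idx w := by rcases hv.1 with rfl | rfl <;> simp [hr]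
    have h2 : idx v = idx x := by rcases hv.2 with rfl | rfl <;> simp [hr]
    rcases hfib w x (h1.symm.trans h2) with rfl | h | h
    · exact hef rfl
    · exact hw h
    · exact hx h
  · intro s a b
    constructor
    · intro h
      refine ⟨ne_of_adj _ h, fun hM => ?_⟩
      obtain ⟨w, hw, he⟩ := Finset.mem_image.1 hM
      obtain ⟨hab, rfl⟩ := Prod.mk.inj he
      rcases h with h | h
      · apply h
        rcases Sym2.eq_iff.1 hab with ⟨rfl, rfl⟩ | ⟨rfl, rfl⟩ <;> rw [hr]
      · exact absurd h.2 (by decide)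
    · rintro ⟨hab, hM⟩
      by_contra h
      simp only [negBlowup, not_or, not_and, not_not] at h
      have hs : s = 1 := (Int.units_eq_one_or s).resolve_right (h.2 hab)
      apply hM
      rw [Finset.mem_image]
      rcases hfib a b h.1 with h' | h' | h'
      · exact absurd h' hab
      · refine ⟨b, (hN b).2 ?_, ?_⟩
        · rw [← h.1, ← h']
          exact hab.symm
        · rw [← h.1, ← h', hs, Sym2.eq_swap]
      · refine ⟨a, (hN a).2 ?_, ?_⟩
        · rw [h.1, ← h']
          exact hab
        · rw [h.1, ← h', hs]

/-- With 2m + 2 vertices in fibers of size at most two, the graph contains a switched positive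
clique. Odd (sb5) with parameter 2m + 1 contracts the two-element fibers one at a time, and `n`
counts the contractions. -/
lemma obtainable_negBlowup [Finite I] (m : ℕ) (hq : q ≤ 2 * m + 2) (hI : Nat.card I = m + 2)
    (n : ℕ) : ∀ {W : Type u} [Finite W] (idx : W → I) (r : I → W), (∀ i, idx (r i) = i) →
      (∀ a b, idx a = idx b → a = b ∨ a = r (idx a) ∨ b = r (idx b)) →
      Nat.card W + n = 2 * m + 2 → Obtainable q (negBlowup idx) := by
  classical
  induction n with
  | zero =>
    intro W _ idx r hr hfib hn
    -- Switching one vertex of each two-element fiber turns its only edge positive; other pairs have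
    -- both signs anyway.
    refine obtainable_of_switched_clique (fun w => if w = r (idx w) then 1 else -1) id
      (by omega) fun a b hab => ?_
    by_cases h : idx a = idx b
    · refine Or.inr ⟨hab, ?_⟩
      rcases hfib a b h with h' | h' | h'
      · exact absurd h' hab
      · have : b ≠ r (idx b) := fun hb => hab (by rw [h', hb, ← h, ← h'])
        rw [if_pos h', if_neg this, one_mul]
      · have : a ≠ r (idx a) := fun ha => hab (by rw [h', ha, h, ← h'])
        rw [if_pos h', if_neg this, mul_one]
    · exact Or.inl h
  | succ n ih =>
    intro W _ idx r hr hfib hn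
    have hrinj : Injective r := fun i j h => by rw [← hr i, h, hr]
    have hIW : Nat.card I ≤ Nat.card W := Nat.card_le_card_of_injective r hrinj
    -- If every fiber had a second vertex, `W` would have at least 2m + 4 vertices. A singleton
    -- fiber can thus be doubled, and the doubled graph is covered by induction.
    obtain ⟨i, hi⟩ : ∃ i, ∀ w, idx w = i → w = r i := by
      by_contra! hcon
      choose t ht ht' using hcon
      have hinj : Injective (Sum.elim r t) := by
        rintro (a | a) (b | b) h <;> simp only [Sum.elim_inl, Sum.elim_inr] at h
        · rw [hrinj h]
        · have := congrArg idx h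
          rw [hr, ht] at this
          subst this
          exact absurd h.symm (ht' _)
        · have := congrArg idx h
          rw [hr, ht] at this
          subst this
          exact absurd h (ht' _)
        · have := congrArg idx h
          rw [ht, ht] at this
          rw [this]
      have := Nat.card_le_card_of_injective _ hinj
      rw [Nat.card_sum] at this
      omega
    let idx' : Option W → I := fun o => o.elim i idx
    have hG : Obtainable q (negBlowup idx') := by
      refine ih idx' (fun j => some (r j)) hr ?_ ?_
      · rintro (_ | a) (_ | b) h
        · exact Or.inl rfl
        · exact Or.inr (Or.inr (congrArg some ((hi b h.symm).trans (congrArg r h))))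
        · exact Or.inr (Or.inl (congrArg some ((hi a h).trans (congrArg r h.symm))))
        · simpa [idx'] using hfib a b h
      · rw [Finite.card_option]
        omega
    -- The m + 2 bijoined representatives exceed the m + 1 available absolute values.
    have hcol : ¬ (negBlowup idx').Colorable (2 * m + 1) := by
      intro h
      have hb : (negBlowup idx').Bijoined (fun j => some (r j)) := fun a b hab s =>
        Or.inl (by simpa [idx', hr] using hab)
      have := hb.card_le (by omega) h
      omega
    let H : SignedBigraph {w : Option W // w ≠ none} := negBlowup fun w => idx' w
    have hH : Obtainable q H := by
      -- The subtraction does not truncate: m + 2 ≤ |W| ≤ 2m + 1 forces m ≥ 1.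
      refine .sb5_odd (2 * m + 1) (m - 1) (by omega) (by omega) hcol (some (r i)) none
        (Or.inr ⟨by simp, rfl⟩) ?_ H ?_ ?_ hG
      · rintro (h | h)
        · exact h (hr i)
        · exact absurd h.2 (by decide)
      · have hx : idx' (some (r i)) = idx' none := hr i
        rintro s a b ⟨hab, ⟨h, -⟩ | ⟨ha, h, -⟩ | ⟨hb, h, -⟩⟩
        · exact h.imp_right fun h => ⟨hab, h.2⟩
        · rcases h with h | h
          · refine Or.inl ?_
            change idx' a ≠ idx' b
            rwa [ha, hx]
          · exact Or.inr ⟨hab, h.2⟩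
        · rcases h with h | h
          · refine Or.inl ?_
            change idx' a ≠ idx' b
            rwa [hb, hx]
          · exact Or.inr ⟨hab, h.2⟩
      · refine negBlowup_isThin _ (fun j => ⟨some (r j), by simp⟩) hr ?_ _ ?_
        · rintro ⟨_ | a, ha⟩ ⟨_ | b, hb⟩ h
          · exact absurd rfl ha
          · exact absurd rfl ha
          · exact absurd rfl hb
          · simpa [idx'] using hfib a b h
        · have : Nat.card {w : Option W // w ≠ none} = Nat.card W :=
            Nat.card_congr (Equiv.optionIsSomeEquiv W |>.symm.trans
              (Equiv.subtypeEquivRight fun _ => Option.ne_none_iff_isSome.symm)).symm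
          omega
    refine obtainable_of_hom _ H (fun w => w.1.get (Option.ne_none_iff_isSome.1 w.2)) rfl ?_ hH
    rintro s ⟨_ | a, ha⟩ ⟨_ | b, hb⟩ h
    · exact absurd rfl ha
    · exact absurd rfl ha
    · exact absurd rfl hb
    · refine h.imp id (And.imp_left fun h => ?_)
      simpa using h

/-- A graph with `m + 2` pairwise bijoined vertices is obtainable if `q ≤ 2 * m + 2`. -/
lemma Bijoined.obtainable [Finite I] [Finite V] {G : SignedBigraph V} {r : I → V}
    (hr : G.Bijoined r) (m : ℕ) (hq : q ≤ 2 * m + 2) (hI : Nat.card I = m + 2) :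
    Obtainable q G := by
  have h := obtainable_negBlowup m hq hI m (id : I → I) id (fun _ => rfl)
    (fun a b h => Or.inl h) (by omega)
  refine obtainable_of_hom _ _ r rfl (fun s a b hab => ?_) h
  exact hr a b (ne_of_adj _ hab) s

/-! ### Maximal graphs that are not obtainable -/

/-- `G` is not obtainable, but becomes so when any edge is added. -/
structure IsMaximalNonobtainable (q : ℕ) (G : SignedBigraph V) : Prop where
  not_obtainable : ¬ Obtainable q G
  obtainable_addEdge : ∀ s x y, x ≠ y → ¬ G.Adj s x y → Obtainable q (G.addEdge s x y)

lemma exists_isMaximalNonobtainable [Finite V] (G : SignedBigraph V) (hG : ¬ Obtainable q G) :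
    ∃ M : SignedBigraph V, G.IsSpanningSubgraph M ∧ IsMaximalNonobtainable q M := by
  have key : ∀ n : ℕ, ∀ G : SignedBigraph V,
      {x : ℤˣ × V × V | ¬ G.Adj x.1 x.2.1 x.2.2}.ncard = n → ¬ Obtainable q G →
      ∃ M : SignedBigraph V, G.IsSpanningSubgraph M ∧ IsMaximalNonobtainable q M := by
    intro n
    induction n using Nat.strong_induction_on with
    | _ n ih =>
      intro G hn hG
      by_cases hall : ∀ s x y, x ≠ y → ¬ G.Adj s x y → Obtainable q (G.addEdge s x y)
      · exact ⟨G, fun _ _ _ h => h, hG, hall⟩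
      · push Not at hall
        obtain ⟨s, x, y, hxy, hadj, hobt⟩ := hall
        obtain ⟨M, hM, hmax⟩ := ih _ (by
          rw [← hn]
          refine Set.ncard_lt_ncard ?_ (Set.toFinite _)
          refine ⟨fun x hx h => hx (Or.inl h), fun hsub => ?_⟩
          exact hsub (show (s, x, y) ∈ _ from hadj) (Or.inr ⟨hxy, rfl, rfl⟩)) _ rfl hobt
        exact ⟨M, fun _ _ _ h => hM _ _ _ (Or.inl h), hmax⟩
  exact key _ G rfl hG

namespace IsMaximalNonobtainable

variable [Finite V] {M : SignedBigraph V}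

/-- Absence of edges is transitive, with multiplication of signs. -/
lemma not_adj_trans (hM : IsMaximalNonobtainable q M) {s t : ℤˣ} {a b c : V} (hab : a ≠ b)
    (hbc : b ≠ c) (hs : ¬ M.Adj s a b) (ht : ¬ M.Adj t b c) :
    ¬ M.Adj (s * t) a c := by
  classical
  intro hadj
  apply hM.not_obtainable
  have h1 := hM.obtainable_addEdge s a b hab hs
  let τ : V → ℤˣ := fun w => if w = c then t else 1
  have hτc : τ c = t := if_pos rfl
  have hτb : τ b = 1 := if_neg hbc
  have h2 := obtainable_switchBy _ (hM.obtainable_addEdge t b c hbc ht) τ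
  have hcb : ((M.addEdge t b c).switchBy τ).Adj 1 c b := by
    refine Or.inr ⟨hbc.symm, ?_, Sym2.eq_swap⟩
    rw [hτc, hτb, mul_one, mul_one]
  -- At the split of b, only the added edge to a moves to c, where it becomes the assumed edge ac of
  -- sign s * t; all other edges stay at b. The added edge bc, made positive by switching c, is the
  -- one removed. Merging the two copies of each vertex maps the result into `M`.
  have h3 := Obtainable.sb3 b (fun u => {w | u = s ∧ w = a}) c b hcb h1 h2
  have mixed : ∀ (u : ℤˣ) (x : {w : V // w ≠ b}) (y : V), (M.addEdge s a b).Adj u b x →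
      ((y = c ∧ u = s ∧ (x : V) = a) ∨ (y = b ∧ ¬ (u = s ∧ (x : V) = a))) →
      M.Adj (τ y * u) x y := by
    rintro u x y hx (⟨rfl, rfl, hxa⟩ | ⟨rfl, hn⟩)
    · rw [hτc, hxa, mul_comm]
      exact hadj
    · rw [hτb, one_mul]
      rcases hx with hx | ⟨-, hu, he⟩
      · exact M.symm _ _ _ hx
      · refine absurd ⟨hu, ?_⟩ hn
        rcases Sym2.eq_iff.1 he with ⟨h, -⟩ | ⟨-, h⟩
        · exact absurd h.symm hab
        · exact h
  refine obtainable_of_switchHom h3 (Sum.elim Subtype.val id) (Sum.elim (fun _ => 1) τ) ?_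
  rintro u (x | x) (y | y) h
  · rcases h with h | ⟨-, -, he⟩
    · simpa using h
    · rcases Sym2.eq_iff.1 he with ⟨-, h⟩ | ⟨h, -⟩
      · exact absurd h y.2
      · exact absurd h x.2
  · simpa using mixed u x y h.1 h.2
  · simpa using M.symm _ _ _ (mixed u y x h.1 h.2)
  · obtain ⟨h | ⟨-, hu, he⟩, hn⟩ := h
    · exact h
    · refine absurd ⟨?_, he.trans Sym2.eq_swap⟩ hn
      rcases Sym2.eq_iff.1 he with ⟨rfl, rfl⟩ | ⟨rfl, rfl⟩
      · rw [hτb, hτc, one_mul] at hu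
        exact mul_eq_left.1 hu
      · rw [hτb, hτc, mul_one] at hu
        exact mul_eq_left.1 hu

/-- Two vertices are related if they are not joined by edges of both signs. -/
def setoid (hM : IsMaximalNonobtainable q M) : Setoid V where
  r a b := ∃ s, ¬ M.Adj s a b
  iseqv :=
    { refl := fun a => ⟨1, M.loopless _ _⟩
      symm := fun ⟨s, h⟩ => ⟨s, fun h' => h (M.symm _ _ _ h')⟩
      trans := by
        rintro a b c ⟨s, hs⟩ ⟨t, ht⟩
        by_cases hab : a = b
        · subst hab
          exact ⟨t, ht⟩
        by_cases hbc : b = c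
        · subst hbc
          exact ⟨s, hs⟩
        exact ⟨s * t, hM.not_adj_trans hab hbc hs ht⟩ }

lemma adj_of_mk_ne (hM : IsMaximalNonobtainable q M) {a b : V}
    (h : (Quotient.mk hM.setoid a) ≠ Quotient.mk hM.setoid b) (s : ℤˣ) : M.Adj s a b := by
  by_contra hs
  exact h (Quotient.sound ⟨s, hs⟩)

lemma bijoined_out (hM : IsMaximalNonobtainable q M) :
    M.Bijoined (Quotient.out : Quotient hM.setoid → V) := fun i j hij s =>
  hM.adj_of_mk_ne (by simpa using hij) s

lemma card_le_of_bijoined (hM : IsMaximalNonobtainable q M) {ι : Type*} {r : ι → V}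
    (hr : M.Bijoined r) : Nat.card ι ≤ Nat.card (Quotient hM.setoid) := by
  refine Nat.card_le_card_of_injective (fun i => Quotient.mk hM.setoid (r i)) fun i j h => ?_
  by_contra hij
  obtain ⟨s, hs⟩ := Quotient.exact h
  exact hs (hr i j hij s)

/-- Every class is antibalanced. -/
lemma exists_signs (hM : IsMaximalNonobtainable q M) : ∃ τ : V → ℤˣ, ∀ s a b, M.Adj s a b →
    Quotient.mk hM.setoid a = Quotient.mk hM.setoid b → s = -(τ a * τ b) := by
  -- The sign of a is that of a missing edge to its class representative. By transitivity the edge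
  -- ab of sign τ a * τ b is missing, so only the opposite sign can occur.
  have hex : ∀ a, ∃ t : ℤˣ, ¬ M.Adj t a (Quotient.mk hM.setoid a).out ∧
      (a = (Quotient.mk hM.setoid a).out → t = 1) := by
    intro a
    by_cases h : a = (Quotient.mk hM.setoid a).out
    · refine ⟨1, ?_, fun _ => rfl⟩
      rw [← h]
      exact M.loopless _ _
    · obtain ⟨t, ht⟩ := Quotient.exact (Quotient.out_eq (Quotient.mk hM.setoid a)).symm
      exact ⟨t, ht, fun h' => absurd h' h⟩
  choose τ hτ hτ1 using hex
  refine ⟨τ, fun s a b hab hcl => ?_⟩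
  have hne := M.ne_of_adj hab
  have habs : ¬ M.Adj (τ a * τ b) a b := by
    have ha := hτ a
    have hb := hτ b
    have ha1 := hτ1 a
    have hb1 := hτ1 b
    rw [← hcl] at hb hb1
    by_cases h1 : a = (Quotient.mk hM.setoid a).out
    · rw [ha1 h1, one_mul]
      rw [← h1] at hb
      exact fun h => hb (M.symm _ _ _ h)
    by_cases h2 : b = (Quotient.mk hM.setoid a).out
    · rw [hb1 h2, mul_one]
      rwa [← h2] at ha
    exact hM.not_adj_trans h1 (Ne.symm h2) ha fun h => hb (M.symm _ _ _ h)
  rcases Int.units_eq_one_or s with rfl | rfl <;>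
  rcases Int.units_eq_one_or (τ a * τ b) with h | h <;> rw [h] at habs ⊢
  · exact absurd hab habs
  · simp
  · exact absurd hab habs

/-- The classes that contain an edge. -/
def edgeClasses (hM : IsMaximalNonobtainable q M) : Set (Quotient hM.setoid) :=
  {C | ∃ s a b, M.Adj s a b ∧ Quotient.mk hM.setoid a = C ∧ Quotient.mk hM.setoid b = C}

/-- Each class gets its own absolute value. The self-opposite colors 0 and p/2 are unusable on a
class with edges, so those classes take the labels 1, ..., b, all below p/2. One edgeless class
takes 0, the others continue from b + 1. -/
lemma colorable (hM : IsMaximalNonobtainable q M) {p : ℕ}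
    (hN : Nat.card (Quotient hM.setoid) ≤ p / 2 + 1)
    (hb : 2 * Nat.card hM.edgeClasses < p) : M.Colorable p := by
  classical
  obtain ⟨τ, hτ⟩ := hM.exists_signs
  have hsum : Nat.card hM.edgeClasses + Nat.card ↥(hM.edgeClasses)ᶜ =
      Nat.card (Quotient hM.setoid) := by
    rw [Nat.card_coe_set_eq, Nat.card_coe_set_eq, Set.ncard_add_ncard_compl]
  let e := Finite.equivFin hM.edgeClasses
  let e' := Finite.equivFin ↥(hM.edgeClasses)ᶜ
  let ℓ : Quotient hM.setoid → ℕ := fun C =>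
    if h : C ∈ hM.edgeClasses then (e ⟨C, h⟩ : ℕ) + 1
    else if (e' ⟨C, h⟩ : ℕ) = 0 then 0 else Nat.card hM.edgeClasses + (e' ⟨C, h⟩ : ℕ)
  have hin : ∀ C (h : C ∈ hM.edgeClasses), ℓ C = (e ⟨C, h⟩ : ℕ) + 1 := fun C h => dif_pos h
  have hout : ∀ C (h : C ∉ hM.edgeClasses), ℓ C =
      if (e' ⟨C, h⟩ : ℕ) = 0 then 0 else Nat.card hM.edgeClasses + (e' ⟨C, h⟩ : ℕ) :=
    fun C h => dif_neg h
  have hinj : Injective ℓ := by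
    intro C D h
    by_cases hC : C ∈ hM.edgeClasses <;> by_cases hD : D ∈ hM.edgeClasses
    · rw [hin C hC, hin D hD] at h
      have := e.injective (Fin.ext (Nat.succ.inj h))
      exact congrArg Subtype.val this
    · rw [hin C hC, hout D hD] at h
      have := (e ⟨C, hC⟩).2
      split_ifs at h
      omega
    · rw [hout C hC, hin D hD] at h
      have := (e ⟨D, hD⟩).2
      split_ifs at h
      omega
    · rw [hout C hC, hout D hD] at h
      have : (e' ⟨C, hC⟩ : ℕ) = e' ⟨D, hD⟩ := by
        split_ifs at h <;> omega
      exact congrArg Subtype.val (e'.injective (Fin.ext this))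
  refine colorable_of_labels (fun v => ℓ (Quotient.mk _ v)) τ (fun v => ?_)
    fun s a b hab hl => ?_
  · by_cases h : Quotient.mk hM.setoid v ∈ hM.edgeClasses
    · have := (e ⟨_, h⟩).2
      simp only [hin _ h]
      omega
    · have := (e' ⟨_, h⟩).2
      simp only [hout _ h]
      split_ifs <;> omega
  · have hcl := hinj hl
    have hmem : Quotient.mk hM.setoid a ∈ hM.edgeClasses := ⟨s, a, b, hab, rfl, hcl.symm⟩
    have := (e ⟨_, hmem⟩).2
    refine ⟨hτ s a b hab hcl, ?_, ?_⟩ <;> simp only [hin _ hmem] <;> omega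

/-- Two adjacent vertices from each class with an edge and one vertex from each other class form a
switched positive complete graph. -/
lemma card_add_card_lt (hM : IsMaximalNonobtainable q M) :
    Nat.card (Quotient hM.setoid) + Nat.card hM.edgeClasses < q := by
  classical
  by_contra! hle
  apply hM.not_obtainable
  have hex : ∀ C : Quotient hM.setoid, ∃ (s : ℤˣ) (a b : V), Quotient.mk hM.setoid a = C ∧
      (C ∈ hM.edgeClasses → Quotient.mk hM.setoid b = C ∧ M.Adj s a b) := by
    intro C
    by_cases h : C ∈ hM.edgeClasses
    · obtain ⟨s, a, b, hab, ha, hb⟩ := h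
      exact ⟨s, a, b, ha, fun _ => ⟨hb, hab⟩⟩
    · exact ⟨1, C.out, C.out, Quotient.out_eq C, fun h' => absurd h' h⟩
  choose s a b ha hb using hex
  refine obtainable_of_switched_clique (V := Quotient hM.setoid ⊕ hM.edgeClasses)
    (Sum.elim (fun _ => 1) fun C => s C) (Sum.elim a fun C => b C)
    (by rwa [Nat.card_sum]) ?_
  rintro (C | C) (D | D) hne
  · refine hM.adj_of_mk_ne ?_ _
    simpa [ha] using hne
  · by_cases h : C = D
    · subst h
      simpa using (hb D D.2).2
    · refine hM.adj_of_mk_ne ?_ _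
      simpa [ha, (hb D D.2).1] using h
  · by_cases h : (C : Quotient hM.setoid) = D
    · subst h
      simpa using M.symm _ _ _ (hb C C.2).2
    · refine hM.adj_of_mk_ne ?_ _
      simpa [ha, (hb C C.2).1] using h
  · refine hM.adj_of_mk_ne ?_ _
    have h : (C : Quotient hM.setoid) ≠ D := fun h => hne (congrArg _ (Subtype.ext h))
    simpa [(hb C C.2).1, (hb D D.2).1] using h

/-- The bounds N + b ≤ p and p ≤ 2b ≤ 2N leave only N = b = p/2; in particular odd p is impossible.
-/
lemma card_quotient (hM : IsMaximalNonobtainable q M) {p : ℕ} (hq : q = p + 1)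
    (hcol : ¬ M.Colorable p) : p = 2 * Nat.card (Quotient hM.setoid) := by
  have h1 := hM.card_add_card_lt
  have h2 : Nat.card (Quotient hM.setoid) ≤ p / 2 + 1 := by
    by_contra! h
    let r : ULift.{u} (Fin (p / 2 + 2)) → V := fun i =>
      ((Finite.equivFin (Quotient hM.setoid)).symm (Fin.castLE h i.down)).out
    have hr : M.Bijoined r := fun i j hij => hM.bijoined_out _ _ fun he =>
      hij (ULift.ext _ _ (Fin.castLE_injective h ((Equiv.injective _) he)))
    exact hM.not_obtainable (hr.obtainable (p / 2) (by omega) (by simp))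
  have h3 : p ≤ 2 * Nat.card hM.edgeClasses := by
    by_contra! h
    exact hcol (hM.colorable h2 h)
  have h4 : Nat.card hM.edgeClasses ≤ Nat.card (Quotient hM.setoid) :=
    Nat.card_le_card_of_injective _ Subtype.val_injective
  omega

end IsMaximalNonobtainable

/-! ### Graphs that are not `p`-colorable -/

/-- Add a vertex joined to the vertices in `S` by edges of both signs. -/
def addApex (G : SignedBigraph V) (S : Set V) : SignedBigraph (Option V) where
  Adj s a b := (∃ a' b', a = some a' ∧ b = some b' ∧ G.Adj s a' b') ∨
    (∃ b' ∈ S, a = none ∧ b = some b') ∨ ∃ a' ∈ S, a = some a' ∧ b = none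
  symm := by
    rintro s a b (⟨a', b', ha, hb, h⟩ | ⟨b', h, ha, hb⟩ | ⟨a', h, ha, hb⟩)
    · exact Or.inl ⟨b', a', hb, ha, G.symm _ _ _ h⟩
    · exact Or.inr (Or.inr ⟨b', h, hb, ha⟩)
    · exact Or.inr (Or.inl ⟨a', h, hb, ha⟩)
  loopless := by
    rintro s (_ | a) (⟨a', b', ha, hb, h⟩ | ⟨b', h, ha, hb⟩ | ⟨a', h, ha, hb⟩) <;> simp_all
    exact G.loopless _ _ h

theorem obtainable_of_not_colorable [Finite V] (G : SignedBigraph V) {p : ℕ} (hp : 0 < p)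
    (hG : ¬ G.Colorable p) : Obtainable (p + 1) G := by
  by_contra hobt
  obtain ⟨M, hGM, hM⟩ := exists_isMaximalNonobtainable G hobt
  have hMcol : ¬ M.Colorable p := fun h => hG (h.of_isSpanningSubgraph hGM)
  have hcard := hM.card_quotient rfl hMcol
  let r : Quotient hM.setoid → V := Quotient.out
  have hr : M.Bijoined r := hM.bijoined_out
  let A := M.addApex (Set.range r)
  have hAcol : ¬ A.Colorable p := by
    rintro ⟨c, hc⟩
    exact hMcol ⟨fun v => c (some v), fun s v w h =>
      hc s _ _ (Or.inl ⟨v, w, rfl, rfl, h⟩)⟩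
  have hA : ¬ Obtainable (p + 1) A := by
    intro h
    apply hM.not_obtainable
    have hnb : A.neighbors none ⊆ Set.range fun i => some (r i) := by
      rintro w ⟨s, ⟨a', b', ha, -⟩ | ⟨_, ⟨i, rfl⟩, -, hb⟩ | ⟨a', -, ha, -⟩⟩
      · cases ha
      · exact ⟨i, hb.symm⟩
      · cases ha
    have hnc : (A.neighbors none).ncard ≤ Nat.card (Quotient hM.setoid) := by
      refine (Set.ncard_le_ncard hnb (Set.toFinite _)).trans ?_
      rw [← Set.image_univ, ← Set.ncard_univ]
      exact Set.ncard_image_le (Set.toFinite _)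
    -- The apex has at most N = p/2 neighbors, exactly the bound that (sb5) allows.
    have hrem := Obtainable.sb5_even p hp le_rfl (hcard ▸ even_two_mul _) hAcol none
      (by omega) h
    refine obtainable_of_hom _ _ (fun w => w.1.get (Option.ne_none_iff_isSome.1 w.2)) rfl ?_ hrem
    rintro s ⟨_ | a, ha⟩ ⟨_ | b, hb⟩ h
    · exact absurd rfl ha
    · exact absurd rfl ha
    · exact absurd rfl hb
    · rcases h with ⟨a', b', h1, h2, h⟩ | ⟨_, -, h, -⟩ | ⟨_, -, -, h⟩
      · cases h1
        cases h2
        exact h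
      · cases h
      · cases h
  obtain ⟨M', hAM, hM'⟩ := exists_isMaximalNonobtainable A hA
  have hcard' := hM'.card_quotient rfl fun h => hAcol (h.of_isSpanningSubgraph hAM)
  -- The apex and the N representatives lie in distinct classes of `M'`, which has only N classes.
  have hr' : M'.Bijoined fun o : Option (Quotient hM.setoid) => o.map r := by
    rintro (_ | i) (_ | j) hij s <;> apply hAM
    · exact absurd rfl hij
    · exact Or.inr (Or.inl ⟨r j, ⟨j, rfl⟩, rfl, rfl⟩)
    · exact Or.inr (Or.inr ⟨r i, ⟨i, rfl⟩, rfl, rfl⟩)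
    · exact Or.inl ⟨r i, r j, rfl, rfl, hr i j (fun h => hij (congrArg some h)) s⟩
  have := hM'.card_le_of_bijoined hr'
  rw [Finite.card_option] at this
  omega

end SignedBigraph

theorem mainTheorem1 {V : Type u} [Finite V] [Nonempty V] (G : SignedBigraph V) (q : ℕ)
    (hq : G.HasChromaticNumber q) : SignedBigraph.Obtainable q G := by
  obtain ⟨⟨hpos, -⟩, hmin⟩ := hq
  obtain ⟨p, rfl⟩ : ∃ p, q = p + 1 := ⟨q - 1, by omega⟩
  rcases Nat.eq_zero_or_pos p with rfl | hp
  -- For q = 1 the start is a single vertex, which maps to any vertex of `G`.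
  · refine SignedBigraph.obtainable_of_hom _ _ (fun _ => Classical.arbitrary V) rfl ?_ .start
    rintro s a b ⟨-, hab⟩
    exact absurd (ULift.ext _ _ (Fin.ext (by omega))) hab
  · refine SignedBigraph.obtainable_of_not_colorable G hp fun h => ?_
    have := hmin ⟨hp, h⟩
    omega
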